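/- Let $G=(\Sigma,\mathcal N,S,\mathcal R,p)$ be a stochastic context-free grammar: $\mathcal N=\{A_1,\dots,A_N\}$ is a finite set of nonterminals, $S\in\mathcal N$ is the start symbol, $\mathcal R$ is a finite set of rules $A\to B$ with $A\in\mathcal N$, $B\in(\mathcal N\cup\Sigma)^*$, and $p:\mathcal R\to[0,1]$. Assume that $G$ is reduced ($p(\pi)>0$ for every $\pi\in\mathcal R$, and every nonterminal occurs in some string derivable from $S$ and derives some string of terminals) and proper ($\sum_{\pi\in\mathcal R_i}p(\pi)=1$ for every $i$, where $\mathcal R_i$ is the set of rules with left-hand side $A_i$). For $\pi\in\mathcal R$ let $r_n(\pi)$ be the number of occurrences of $A_n$ on the right-hand side of $\pi$, let $M_{i,n}=\sum_{\pi\in\mathcal R_i}p(\pi)\,r_n(\pi)$ be the expectation matrix, and assume that its spectral radius satisfies $\rho(M)<1$. Let $\Omega_i$ be the set of all left-most derivations $\boldsymbol\pi=\pi_1\cdots\pi_L$ that start at $A_i$ and end in a string of terminals, and put $p(\boldsymbol\pi)=p(\pi_1)\cdots p(\pi_L)$. Let $Y:\mathcal R\to\mathbb R^D$, and let $X$ be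 an $\mathbb R^D$-valued function on $\Omega=\bigcup_i\Omega_i$ with $X(\pi_1\cdots\pi_L)=Y(\pi_1)+\cdots+Y(\pi_L)$. For multi-indices $\alpha,\beta\in\mathbb N_0^D$, $\beta\le\alpha$ is meant coordinatewise, and $\beta<\alpha$ means $\beta\le\alpha$ and $\beta\ne\alpha$; powers, factorials and binomial coefficients of multi-indices are the products of those of the coordinates, and $\binom{\alpha}{\beta_1,\dots,\beta_k}=\frac{\alpha!}{\beta_1!\cdots\beta_k!}$. Then the following hold. 1. For all $\alpha\in\mathbb N_0^D$ and all $i$, the series $m_i^{(\alpha)}=\sum_{\boldsymbol\pi\in\Omega_i}p(\boldsymbol\pi)\,X(\boldsymbol\pi)^{\alpha}$ converges absolutely, and $m_i^{(0)}=1$. 2. The matrix $I-M$ is invertible. 3. For every $\alpha\neq 0$, the vector $m^{(\alpha)}=(m^{(\alpha)}_1,\dots,m^{(\alpha)}_N)^T$ satisfies $$m^{(\alpha)}=M\,m^{(\alpha)}+c^{(\alpha)},$$ it is the only solution $v\in\mathbb R^N$ of $v=Mv+c^{(\alpha)}$, and $m^{(\alpha)}=(I-M)^{-1}c^{(\alpha)}$.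 Here $c^{(\alpha)}=(c^{(\alpha)}_1,\dots,c^{(\alpha)}_N)^T$ depends only on $p$, $Y$ and the moments $m^{(\beta)}$ with $\beta<\alpha$, and is given by $$c_i^{(\alpha)}=\sum_{\pi\in\mathcal R_i}p(\pi)\sum_{n=1}^{N}\ \sum_{\substack{\delta_1+\cdots+\delta_{r_n(\pi)}=\alpha\\ \delta_1,\dots,\delta_{r_n(\pi)}<\alpha}}\binom{\alpha}{\delta_1,\dots,\delta_{r_n(\pi)}}\prod_{l=1}^{r_n(\pi)}m_n^{(\delta_l)} +\sum_{\pi\in\mathcal R_i}p(\pi)\sum_{\substack{\gamma_1+\cdots+\gamma_N=\alpha\\ \gamma_1,\dots,\gamma_N<\alpha}}H_\pi^{\alpha}(\gamma_1,\dots,\gamma_N) +\sum_{\pi\in\mathcal R_i}\sum_{\beta<\alpha}Q_\pi(\alpha,\beta),$$ where $$H_\pi^{\beta}(\gamma_1,\dots,\gamma_N)=\binom{\beta}{\gamma_1,\dots,\gamma_N}\prod_{k=1}^{N}\ \sum_{\delta_1+\cdots+\delta_{r_k(\pi)}=\gamma_k}\binom{\gamma_k}{\delta_1,\dots,\delta_{r_k(\pi)}}\prod_{l=1}^{r_k(\pi)}m_k^{(\delta_l)},$$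 $$Q_\pi(\alpha,\beta)=\binom{\alpha}{\beta}\,p(\pi)\,Y(\pi)^{\alpha-\beta}\sum_{\gamma_1+\cdots+\gamma_N=\beta}H_\pi^{\beta}(\gamma_1,\dots,\gamma_N).$$ (An empty sum of multi-indices is $0$ and an empty product is $1$.) -/

import Mathlib

open scoped Matrix Nat

/-! ### Multi-index notation -/

/-- `z ^ γ = z₁ ^ γ₁ ⋯ z_D ^ γ_D`. -/
def multiPow {D : ℕ} (z : Fin D → ℝ) (γ : Fin D → ℕ) : ℝ :=
  ∏ d, z d ^ γ d

/-- `α ! = α₁ ! ⋯ α_D !`. -/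
def multiFactorial {D : ℕ} (α : Fin D → ℕ) : ℕ :=
  ∏ d, (α d)!

/-- The product of the binomial coefficients of the coordinates. -/
def multiChoose {D : ℕ} (α β : Fin D → ℕ) : ℕ :=
  ∏ d, (α d).choose (β d)

/-- The multinomial coefficient `α ! / (β₁ ! ⋯ β_N !)`. -/
noncomputable def multiMultinomial {D : ℕ} {ι : Type*} [Fintype ι]
    (α : Fin D → ℕ) (β : ι → Fin D → ℕ) : ℝ :=
  (multiFactorial α : ℝ) / ∏ k, (multiFactorial (β k) : ℝ)

/-- The families `(β_k)` of multi-indices with `∑ k, β_k = α`. -/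
def splittings {D : ℕ} (ι : Type*) [Fintype ι] [DecidableEq ι] (α : Fin D → ℕ) :
    Finset (ι → Fin D → ℕ) :=
  (Fintype.piFinset fun _ : ι => Finset.Iic α).filter fun β => ∑ k, β k = α

/-- The families `(β_k)` of multi-indices with `∑ k, β_k = α` and every `β_k < α`,
that is, `β_k ≤ α` and `β_k ≠ α`. -/
def properSplittings {D : ℕ} (ι : Type*) [Fintype ι] [DecidableEq ι] (α : Fin D → ℕ) :
    Finset (ι → Fin D → ℕ) :=
  (Fintype.piFinset fun _ : ι => Finset.Iio α).filter fun β => ∑ k, β k = α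

/-! ### Stochastic context-free grammars -/

/-- A stochastic context-free grammar over the terminals `T`: a context-free grammar with finitely
many nonterminals and finitely many rules, whose rules carry weights in `[0, 1]`. -/
structure SCFG (T : Type*) extends ContextFreeGrammar T where
  [fintypeNT : Fintype NT]
  [decidableEqNT : DecidableEq NT]
  prob : {r : ContextFreeRule T NT // r ∈ rules} → ℝ
  prob_mem : ∀ r, prob r ∈ Set.Icc (0 : ℝ) 1

attribute [instance] SCFG.fintypeNT SCFG.decidableEqNT

namespace SCFG

variable {T : Type*}

/-- The rules of the grammar. -/
abbrev Rule (G : SCFG T) : Type _ :=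
  {r : ContextFreeRule T G.NT // r ∈ G.rules}

/-- The left-most rewriting relation: the left-most nonterminal of `v` is the premise of `π`, and
`w` arises from `v` by replacing it with the right-hand side of `π`. -/
def LeftmostRewrites (G : SCFG T) (v : List (Symbol T G.NT)) (π : G.Rule)
    (w : List (Symbol T G.NT)) : Prop :=
  ∃ (u : List T) (δ : List (Symbol T G.NT)),
    v = u.map Symbol.terminal ++ [Symbol.nonterminal π.1.input] ++ δ ∧
    w = u.map Symbol.terminal ++ π.1.output ++ δ

/-- `G.DerivesBy v πs w`: applying the rules of the list `πs` in order, each to the left-most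
nonterminal, leads from `v` to `w`. -/
inductive DerivesBy (G : SCFG T) :
    List (Symbol T G.NT) → List G.Rule → List (Symbol T G.NT) → Prop
  | nil (v : List (Symbol T G.NT)) : DerivesBy G v [] v
  | cons {v w x : List (Symbol T G.NT)} {π : G.Rule} {πs : List G.Rule}
      (h : G.LeftmostRewrites v π w) (hs : DerivesBy G w πs x) : DerivesBy G v (π :: πs) x

/-- `Ω_i`: the left-most derivations that start at the nonterminal `i` and end in a string of
terminals. -/
def Omega (G : SCFG T) (i : G.NT) : Set (List G.Rule) :=
  {πs | ∃ u : List T, G.DerivesBy [Symbol.nonterminal i] πs (u.map Symbol.terminal)}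

/-- The nonterminal derives some string of terminals. -/
def Productive (G : SCFG T) (i : G.NT) : Prop :=
  (G.Omega i).Nonempty

/-- The nonterminal occurs in a string that can be derived from the start symbol. -/
def Accessible (G : SCFG T) (i : G.NT) : Prop :=
  ∃ (πs : List G.Rule) (η ξ : List (Symbol T G.NT)),
    G.DerivesBy [Symbol.nonterminal G.initial] πs (η ++ [Symbol.nonterminal i] ++ ξ)

/-- All rules have positive weight and all nonterminals are useful. -/
def Reduced (G : SCFG T) : Prop :=
  (∀ π : G.Rule, 0 < G.prob π) ∧ ∀ i : G.NT, G.Accessible i ∧ G.Productive i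

/-- `R_i`: the rules with premise `i`. -/
def rulesFrom (G : SCFG T) (i : G.NT) : Finset G.Rule :=
  Finset.univ.filter fun π => π.1.input = i

/-- For each nonterminal, the weights of its rules add up to one. -/
def Proper (G : SCFG T) : Prop :=
  ∀ i : G.NT, ∑ π ∈ G.rulesFrom i, G.prob π = 1

open Classical in
/-- `r_n(π)`: the number of occurrences of the nonterminal `n` on the right-hand side of `π`. -/
noncomputable def occ (G : SCFG T) (π : G.Rule) (n : G.NT) : ℕ :=
  π.1.output.count (Symbol.nonterminal n)

/-- The expectation matrix `M_{i,n} = ∑ p(π) r_n(π)`, the sum over the rules `π` with premise `i`. -/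
noncomputable def expectationMatrix (G : SCFG T) : Matrix G.NT G.NT ℝ :=
  Matrix.of fun i n => ∑ π ∈ G.rulesFrom i, G.prob π * (G.occ π n : ℝ)

/-- The spectral radius `ρ(M)`: the largest modulus of a complex eigenvalue of `M`. -/
noncomputable def rho (G : SCFG T) : ENNReal :=
  spectralRadius ℂ (G.expectationMatrix.map (algebraMap ℝ ℂ))

/-- The weight of a derivation: the product of the weights of its rules. -/
def derivProb (G : SCFG T) (πs : List G.Rule) : ℝ :=
  (πs.map G.prob).prod

/-! ### Cross-moments -/

/-- The cross-moment `m_i^(α) = ∑_{π ∈ Ω_i} p(π) X(π) ^ α`. -/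
noncomputable def moment (G : SCFG T) {D : ℕ} (X : List G.Rule → Fin D → ℝ) (α : Fin D → ℕ)
    (i : G.NT) : ℝ :=
  ∑' πs : G.Omega i, G.derivProb πs * multiPow (X πs) α

/-! In the following expressions `m δ k` stands for the cross-moment of order `δ` at the
nonterminal `k`. -/

/-- `∑_{δ_1 + ⋯ + δ_r = γ} (γ over δ_1, …, δ_r) ∏_l m_k^(δ_l)`, where `r = r_k(π)`. -/
noncomputable def powTerm (G : SCFG T) {D : ℕ} (m : (Fin D → ℕ) → G.NT → ℝ) (π : G.Rule)
    (k : G.NT) (γ : Fin D → ℕ) : ℝ :=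
  ∑ δ ∈ splittings (Fin (G.occ π k)) γ, multiMultinomial γ δ * ∏ l, m (δ l) k

/-- `H_π(γ) = (α over (γ_k)) ∏_k ∑_{δ_1 + ⋯ + δ_r = γ_k} (γ_k over δ_1, …, δ_r) ∏_l m_k^(δ_l)`,
where `r = r_k(π)`. -/
noncomputable def H (G : SCFG T) {D : ℕ} (m : (Fin D → ℕ) → G.NT → ℝ) (π : G.Rule)
    (α : Fin D → ℕ) (γ : G.NT → Fin D → ℕ) : ℝ :=
  multiMultinomial α γ * ∏ k, G.powTerm m π k (γ k)

/-- `Q_π(α, β) = (α over β) p(π) Y(π) ^ (α - β) ∑_{∑ γ_k = β} H_π(γ)`, where the top entry of the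
multinomial coefficient in `H_π(γ)` is `β`. -/
noncomputable def Q (G : SCFG T) {D : ℕ} (Y : G.Rule → Fin D → ℝ)
    (m : (Fin D → ℕ) → G.NT → ℝ) (π : G.Rule) (α β : Fin D → ℕ) : ℝ :=
  (multiChoose α β : ℝ) * G.prob π * multiPow (Y π) (α - β) *
    ∑ γ ∈ splittings G.NT β, G.H m π β γ

/-- The inhomogeneous term `c_i^(α)` of the moment system. -/
noncomputable def c (G : SCFG T) {D : ℕ} (Y : G.Rule → Fin D → ℝ)
    (m : (Fin D → ℕ) → G.NT → ℝ) (α : Fin D → ℕ) (i : G.NT) : ℝ :=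
  (∑ π ∈ G.rulesFrom i, G.prob π *
      ∑ n, ∑ δ ∈ properSplittings (Fin (G.occ π n)) α,
        multiMultinomial α δ * ∏ l, m (δ l) n) +
    (∑ π ∈ G.rulesFrom i, G.prob π * ∑ γ ∈ properSplittings G.NT α, G.H m π α γ) +
    ∑ π ∈ G.rulesFrom i, ∑ β ∈ Finset.Iio α, G.Q Y m π α β

end SCFG

/-! A terminating left-most derivation of a string splits uniquely into derivations of its symbols,
because such derivations form a prefix code (`appendEquiv`). A derivation from A_i is a rule
followed by a derivation of its right-hand side (`nonterminalConsEquiv`). Hence the formal series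
F_i = ∑_α m_i^(α) z^α / α! satisfy F_i = ∑_π p(π) exp(Y(π)·z) ∏_k F_k^(r_k(π)), the sum being over
the rules of A_i (`momentSeries_nonterminal`, `momentSeries_eq_stringProd`). Comparing coefficients
at α gives the system: moments of order α enter only linearly, with matrix M because m^(0) = 1, and
all other terms form c^(α).

For convergence, a vector z ≥ 0 with ∑_π q(π) ∏_k z_k^(r_k(π)) ≤ z_i for all i bounds the total
q-weight of the derivations (`tsum_derivationsFrom_le`). For q = p the vector 1 is a fixed point by
properness, and the derivative there is M. Since ρ(M) < 1, some w ≥ 0 has Mw < w, so 1 + εw is a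
strict supersolution for small ε > 0. Strictness survives replacing p by p·exp(t∑|Y_d|) for small t
> 0, so exponential moments are finite and dominate every X^α.

The vector z = m^(0) is a fixed point with 0 ≤ z ≤ 1, and Bernoulli's inequality gives 1 - z ≤ M(1 -
z). Iterating, M^k → 0 forces z = 1. The same decay makes I - M injective, hence invertible. -/

namespace SCFG

variable {T : Type*}

/-- The left-most derivations that start at the string `v` and end in a string of terminals. -/
def derivationsFrom (G : SCFG T) (v : List (Symbol T G.NT)) : Set (List G.Rule) :=
  {πs | ∃ u : List T, G.DerivesBy v πs (u.map Symbol.terminal)}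

/-! ### Unique factorization of left-most derivations. -/

section Combinatorics

variable {G : SCFG T}

theorem leftmost_decomposition_unique {u u' : List T} {i i' : G.NT}
    {δ δ' : List (Symbol T G.NT)}
    (h : u.map Symbol.terminal ++ Symbol.nonterminal i :: δ =
      u'.map Symbol.terminal ++ Symbol.nonterminal i' :: δ') : u = u' ∧ i = i' ∧ δ = δ' := by
  induction u generalizing u' with
  | nil => cases u' <;> simp_all
  | cons a u ih =>
    cases u' with
    | nil => simp at h
    | cons b u' =>
      simp only [List.map_cons, List.cons_append, List.cons.injEq, Symbol.terminal.injEq] at h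
      obtain ⟨rfl, h⟩ := h
      simpa using ih h

theorem terminals_ne {u u' : List T} {i : G.NT} {δ : List (Symbol T G.NT)} :
    u'.map Symbol.terminal ≠ u.map Symbol.terminal ++ Symbol.nonterminal i :: δ := by
  intro h
  have : (Symbol.nonterminal i : Symbol T G.NT) ∈ u'.map Symbol.terminal := by rw [h]; simp
  simp at this

theorem LeftmostRewrites.unique {v w w' : List (Symbol T G.NT)} {π : G.Rule}
    (h : G.LeftmostRewrites v π w) (h' : G.LeftmostRewrites v π w') : w = w' := by
  obtain ⟨u, δ, rfl, rfl⟩ := h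
  obtain ⟨u', δ', e, rfl⟩ := h'
  simp only [List.append_assoc, List.singleton_append] at e
  obtain ⟨rfl, -, rfl⟩ := leftmost_decomposition_unique e
  rfl

theorem LeftmostRewrites.append_right {v w : List (Symbol T G.NT)} {π : G.Rule}
    (h : G.LeftmostRewrites v π w) (x : List (Symbol T G.NT)) :
    G.LeftmostRewrites (v ++ x) π (w ++ x) := by
  obtain ⟨u, δ, rfl, rfl⟩ := h
  exact ⟨u, δ ++ x, by simp, by simp⟩

theorem LeftmostRewrites.append_left {v w : List (Symbol T G.NT)} {π : G.Rule}
    (h : G.LeftmostRewrites v π w) (u : List T) :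
    G.LeftmostRewrites (u.map Symbol.terminal ++ v) π (u.map Symbol.terminal ++ w) := by
  obtain ⟨u', δ, rfl, rfl⟩ := h
  exact ⟨u ++ u', δ, by simp, by simp⟩

theorem DerivesBy.append_right {v w : List (Symbol T G.NT)} {πs : List G.Rule}
    (h : G.DerivesBy v πs w) (x : List (Symbol T G.NT)) :
    G.DerivesBy (v ++ x) πs (w ++ x) := by
  induction h with
  | nil v => exact .nil _
  | cons h _ ih => exact .cons (h.append_right x) ih

theorem DerivesBy.append_left {v w : List (Symbol T G.NT)} {πs : List G.Rule}
    (h : G.DerivesBy v πs w) (u : List T) :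
    G.DerivesBy (u.map Symbol.terminal ++ v) πs (u.map Symbol.terminal ++ w) := by
  induction h with
  | nil v => exact .nil _
  | cons h _ ih => exact .cons (h.append_left u) ih

theorem DerivesBy.trans {v w x : List (Symbol T G.NT)} {πs πs' : List G.Rule}
    (h : G.DerivesBy v πs w) (h' : G.DerivesBy w πs' x) : G.DerivesBy v (πs ++ πs') x := by
  induction h with
  | nil v => exact h'
  | cons h _ ih => exact .cons h (ih h')

theorem not_leftmostRewrites_terminals {u : List T} {π : G.Rule} {w : List (Symbol T G.NT)} :
    ¬ G.LeftmostRewrites (u.map Symbol.terminal) π w := by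
  rintro ⟨u', δ, h, -⟩
  simp only [List.append_assoc, List.singleton_append] at h
  exact terminals_ne h

theorem nil_mem_derivationsFrom {v : List (Symbol T G.NT)} :
    [] ∈ G.derivationsFrom v ↔ ∃ u : List T, v = u.map Symbol.terminal := by
  constructor
  · rintro ⟨u, h⟩
    cases h
    exact ⟨u, rfl⟩
  · rintro ⟨u, rfl⟩
    exact ⟨u, .nil _⟩

theorem cons_mem_derivationsFrom {v : List (Symbol T G.NT)} {π : G.Rule} {πs : List G.Rule} :
    π :: πs ∈ G.derivationsFrom v ↔
      ∃ w, G.LeftmostRewrites v π w ∧ πs ∈ G.derivationsFrom w := by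
  constructor
  · rintro ⟨u, h⟩
    cases h with
    | cons h hs => exact ⟨_, h, u, hs⟩
  · rintro ⟨w, h, u, hs⟩
    exact ⟨u, .cons h hs⟩

theorem derivationsFrom_terminals (u : List T) :
    G.derivationsFrom (u.map Symbol.terminal) = {[]} := by
  ext πs
  cases πs with
  | nil => simp [nil_mem_derivationsFrom]
  | cons π πs => simp [cons_mem_derivationsFrom, not_leftmostRewrites_terminals]

theorem derivationsFrom_nil : G.derivationsFrom [] = {[]} :=
  derivationsFrom_terminals []

theorem derivationsFrom_terminal_cons (a : T) (v : List (Symbol T G.NT)) :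
    G.derivationsFrom (Symbol.terminal a :: v) = G.derivationsFrom v := by
  ext πs
  induction πs generalizing v with
  | nil =>
    simp only [nil_mem_derivationsFrom]
    constructor
    · rintro ⟨_ | ⟨b, u⟩, h⟩
      · simp at h
      · exact ⟨u, by simp_all⟩
    · rintro ⟨u, rfl⟩
      exact ⟨a :: u, rfl⟩
  | cons π πs ih =>
    simp only [cons_mem_derivationsFrom]
    constructor
    · rintro ⟨w, ⟨_ | ⟨b, u⟩, δ, h, rfl⟩, hs⟩
      · simp at h
      · simp only [List.map_cons, List.cons_append, List.cons.injEq, Symbol.terminal.injEq] at h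
        simp only [List.map_cons, List.cons_append] at hs
        obtain ⟨rfl, rfl⟩ := h
        exact ⟨_, ⟨u, δ, rfl, rfl⟩, (ih _).1 hs⟩
    · rintro ⟨w, h, hs⟩
      exact ⟨_, h.append_left [a], (ih _).2 hs⟩

theorem cons_mem_derivationsFrom_nonterminal_cons {i : G.NT} {v : List (Symbol T G.NT)}
    {π : G.Rule} {πs : List G.Rule} :
    π :: πs ∈ G.derivationsFrom (Symbol.nonterminal i :: v) ↔
      π.1.input = i ∧ πs ∈ G.derivationsFrom (π.1.output ++ v) := by
  rw [cons_mem_derivationsFrom]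
  constructor
  · rintro ⟨w, ⟨_ | ⟨b, u⟩, δ, h, rfl⟩, hs⟩
    · simp only [List.map_nil, List.nil_append, List.singleton_append, List.cons.injEq,
        Symbol.nonterminal.injEq] at h hs
      obtain ⟨rfl, rfl⟩ := h
      exact ⟨rfl, hs⟩
    · simp at h
  · rintro ⟨rfl, hs⟩
    exact ⟨_, ⟨[], v, rfl, rfl⟩, by simpa using hs⟩

theorem nil_notMem_derivationsFrom_nonterminal_cons {i : G.NT} {v : List (Symbol T G.NT)} :
    [] ∉ G.derivationsFrom (Symbol.nonterminal i :: v) := by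
  rw [nil_mem_derivationsFrom]
  rintro ⟨u, h⟩
  exact terminals_ne (u := []) h.symm

/-- A derivation whose left-most symbol is a nonterminal is a rule for that nonterminal, followed
by a derivation from the rewritten string. -/
noncomputable def nonterminalConsEquiv (G : SCFG T) (i : G.NT) (v : List (Symbol T G.NT)) :
    (Σ π : G.rulesFrom i, G.derivationsFrom (π.1.1.output ++ v)) ≃
      G.derivationsFrom (Symbol.nonterminal i :: v) :=
  Equiv.ofBijective
    (fun x => ⟨x.1.1 :: x.2.1, cons_mem_derivationsFrom_nonterminal_cons.2
      ⟨(Finset.mem_filter.1 x.1.2).2, x.2.2⟩⟩) <| by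
    constructor
    · rintro ⟨⟨π, h⟩, ⟨πs, hs⟩⟩ ⟨⟨π', h'⟩, ⟨πs', hs'⟩⟩ e
      simp only [Subtype.mk.injEq, List.cons.injEq] at e
      obtain ⟨rfl, rfl⟩ := e
      rfl
    · rintro ⟨_ | ⟨π, πs⟩, h⟩
      · exact absurd h nil_notMem_derivationsFrom_nonterminal_cons
      · obtain ⟨h₁, h₂⟩ := cons_mem_derivationsFrom_nonterminal_cons.1 h
        exact ⟨⟨⟨π, by simp [rulesFrom, h₁]⟩, ⟨πs, h₂⟩⟩, rfl⟩

@[simp]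
theorem coe_nonterminalConsEquiv (i : G.NT) (v : List (Symbol T G.NT))
    (x : Σ π : G.rulesFrom i, G.derivationsFrom (π.1.1.output ++ v)) :
    (G.nonterminalConsEquiv i v x : List G.Rule) = x.1.1 :: x.2.1 := rfl

theorem append_mem_derivationsFrom {v w : List (Symbol T G.NT)} {a b : List G.Rule}
    (ha : a ∈ G.derivationsFrom v) (hb : b ∈ G.derivationsFrom w) :
    a ++ b ∈ G.derivationsFrom (v ++ w) := by
  obtain ⟨u, ha⟩ := ha
  obtain ⟨u', hb⟩ := hb
  refine ⟨u ++ u', ?_⟩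
  rw [List.map_append]
  exact (ha.append_right w).trans (hb.append_left u)

/-- The induction is on the derivation, since rewriting may lengthen the string; an inner induction
on `v` strips leading terminals. -/
theorem exists_append_of_mem_derivationsFrom {v w : List (Symbol T G.NT)} {πs : List G.Rule}
    (h : πs ∈ G.derivationsFrom (v ++ w)) :
    ∃ a ∈ G.derivationsFrom v, ∃ b ∈ G.derivationsFrom w, a ++ b = πs := by
  induction v generalizing πs w with
  | nil => exact ⟨[], by simp [derivationsFrom_nil], πs, h, rfl⟩
  | cons s v _ =>
  -- The induction on `v` has served only to settle the empty string; its hypothesis is dropped.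
  clear * - h
  generalize s :: v = v at h
  clear s
  induction πs generalizing v with
  | nil =>
    obtain ⟨u, hu⟩ := nil_mem_derivationsFrom.1 h
    obtain ⟨u₁, u₂, -, h₁, h₂⟩ := List.map_eq_append_iff.1 hu.symm
    exact ⟨[], nil_mem_derivationsFrom.2 ⟨u₁, h₁.symm⟩, [],
      nil_mem_derivationsFrom.2 ⟨u₂, h₂.symm⟩, rfl⟩
  | cons π πs ih =>
    induction v with
    | nil => exact ⟨[], by simp [derivationsFrom_nil], _, h, rfl⟩
    | cons s v ihv =>
      cases s with
      | terminal a =>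
        rw [List.cons_append, derivationsFrom_terminal_cons] at h
        rw [derivationsFrom_terminal_cons]
        exact ihv h
      | nonterminal i =>
        rw [List.cons_append, cons_mem_derivationsFrom_nonterminal_cons, ← List.append_assoc] at h
        obtain ⟨a, ha, b, hb, rfl⟩ := ih _ h.2
        exact ⟨π :: a, cons_mem_derivationsFrom_nonterminal_cons.2 ⟨h.1, ha⟩, b, hb, rfl⟩

/-- The list of rules determines every intermediate string, and no rule applies to a terminal
string, so neither derivation can outlast the other. -/
theorem derivationsFrom_prefix_free {v : List (Symbol T G.NT)} {a b c d : List G.Rule}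
    (ha : a ∈ G.derivationsFrom v) (hb : b ∈ G.derivationsFrom v) (h : a ++ c = b ++ d) :
    a = b ∧ c = d := by
  induction a generalizing b v with
  | nil =>
    obtain ⟨u, rfl⟩ := nil_mem_derivationsFrom.1 ha
    rw [derivationsFrom_terminals] at hb
    cases hb
    exact ⟨rfl, h⟩
  | cons π a ih =>
    cases b with
    | nil =>
      obtain ⟨u, rfl⟩ := nil_mem_derivationsFrom.1 hb
      simp [derivationsFrom_terminals] at ha
    | cons π' b =>
      simp only [List.cons_append, List.cons.injEq] at h
      obtain ⟨rfl, h⟩ := h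
      obtain ⟨w, hw, ha⟩ := cons_mem_derivationsFrom.1 ha
      obtain ⟨w', hw', hb⟩ := cons_mem_derivationsFrom.1 hb
      obtain rfl := hw.unique hw'
      obtain ⟨rfl, rfl⟩ := ih ha hb h
      exact ⟨rfl, rfl⟩

/-- A left-most derivation from `v ++ w` is a derivation from `v` followed by one from `w`. -/
noncomputable def appendEquiv (G : SCFG T) (v w : List (Symbol T G.NT)) :
    G.derivationsFrom v × G.derivationsFrom w ≃ G.derivationsFrom (v ++ w) :=
  Equiv.ofBijective
    (fun x => ⟨x.1.1 ++ x.2.1, append_mem_derivationsFrom x.1.2 x.2.2⟩) <| by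
    constructor
    · rintro ⟨⟨a, ha⟩, ⟨b, hb⟩⟩ ⟨⟨a', ha'⟩, ⟨b', hb'⟩⟩ e
      simp only [Subtype.mk.injEq] at e
      obtain ⟨rfl, rfl⟩ := derivationsFrom_prefix_free ha ha' e
      rfl
    · rintro ⟨πs, h⟩
      obtain ⟨a, ha, b, hb, rfl⟩ := exists_append_of_mem_derivationsFrom h
      exact ⟨⟨⟨a, ha⟩, ⟨b, hb⟩⟩, rfl⟩

@[simp]
theorem coe_appendEquiv (v w : List (Symbol T G.NT))
    (x : G.derivationsFrom v × G.derivationsFrom w) :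
    (G.appendEquiv v w x : List G.Rule) = x.1.1 ++ x.2.1 := rfl

end Combinatorics

/-! ### Monomials attached to strings. -/

/-- The product over the nonterminals of a string. -/
def stringProd (G : SCFG T) {R : Type*} [CommMonoid R] (z : G.NT → R)
    (v : List (Symbol T G.NT)) : R :=
  (v.map fun s => match s with
    | Symbol.terminal _ => 1
    | Symbol.nonterminal i => z i).prod

section StringProd

variable {G : SCFG T} {R : Type*} [CommMonoid R] (z : G.NT → R)

@[simp]
theorem stringProd_nil : G.stringProd z [] = 1 := rfl

@[simp]
theorem stringProd_terminal_cons (a : T) (v : List (Symbol T G.NT)) :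
    G.stringProd z (Symbol.terminal a :: v) = G.stringProd z v := by
  simp [stringProd]

@[simp]
theorem stringProd_nonterminal_cons (i : G.NT) (v : List (Symbol T G.NT)) :
    G.stringProd z (Symbol.nonterminal i :: v) = z i * G.stringProd z v := by
  simp [stringProd]

theorem stringProd_append (v w : List (Symbol T G.NT)) :
    G.stringProd z (v ++ w) = G.stringProd z v * G.stringProd z w := by
  simp [stringProd]

theorem stringProd_eq_prod_pow_count [DecidableEq (Symbol T G.NT)] (v : List (Symbol T G.NT)) :
    G.stringProd z v = ∏ k, z k ^ v.count (Symbol.nonterminal k) := by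
  induction v with
  | nil => simp
  | cons s v ih =>
    cases s with
    | terminal a => simp [ih]
    | nonterminal i =>
      simp only [stringProd_nonterminal_cons, ih, List.count_cons, pow_add,
        Finset.prod_mul_distrib, beq_iff_eq, Symbol.nonterminal.injEq]
      simp [pow_ite, mul_comm]

theorem stringProd_output (π : G.Rule) :
    G.stringProd z π.1.output = ∏ k, z k ^ G.occ π k := by
  classical
  exact stringProd_eq_prod_pow_count z _

end StringProd

/-! ### Supersolutions bound the total weight of derivations. -/

section Bound

variable {G : SCFG T}

theorem tsum_derivationsFrom_nil {R : Type*} [AddCommMonoid R] [TopologicalSpace R]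
    (f : List G.Rule → R) : ∑' πs : G.derivationsFrom [], f πs = f [] := by
  rw [derivationsFrom_nil]
  exact tsum_singleton [] f

open scoped ENNReal

/-- Truncating at length `L` makes induction possible without any convergence assumption: a leading
terminal shortens `v`, and a leading nonterminal uses up one rule and lowers `L`. -/
theorem tsum_derivationsFrom_length_le {q : G.Rule → ℝ≥0∞} {z : G.NT → ℝ≥0∞}
    (h : ∀ i, ∑ π ∈ G.rulesFrom i, q π * G.stringProd z π.1.output ≤ z i) (L : ℕ)
    (v : List (Symbol T G.NT)) :
    ∑' πs : G.derivationsFrom v, (if πs.1.length ≤ L then (πs.1.map q).prod else 0) ≤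
      G.stringProd z v := by
  induction L generalizing v with
  | zero =>
    induction v with
    | nil =>
      rw [tsum_derivationsFrom_nil fun πs => if πs.length ≤ 0 then (πs.map q).prod else 0]
      simp
    | cons s v ih =>
      cases s with
      | terminal a => rw [derivationsFrom_terminal_cons]; simpa using ih
      | nonterminal i =>
        rw [← (G.nonterminalConsEquiv i v).tsum_eq]
        simp
  | succ L ihL =>
    induction v with
    | nil =>
      rw [tsum_derivationsFrom_nil fun πs => if πs.length ≤ L + 1 then (πs.map q).prod else 0]
      simp
    | cons s v ih =>
      cases s with
      | terminal a => rw [derivationsFrom_terminal_cons]; simpa using ih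
      | nonterminal i =>
        rw [← (G.nonterminalConsEquiv i v).tsum_eq, ENNReal.tsum_sigma', tsum_fintype,
          stringProd_nonterminal_cons]
        -- The supersolution inequality replaces `z i` by the sum over its rules, to be compared
        -- rule by rule.
        refine le_trans ?_ (mul_le_mul' (h i) le_rfl)
        rw [Finset.sum_mul, ← Finset.sum_coe_sort (G.rulesFrom i)]
        refine Finset.sum_le_sum fun π _ => ?_
        rw [mul_assoc, ← stringProd_append]
        refine le_trans (le_of_eq ?_) (mul_le_mul' le_rfl (ihL _))
        rw [← ENNReal.tsum_mul_left]
        refine tsum_congr fun πs => ?_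
        simp [mul_ite]

/-- A supersolution of the fixed point equations bounds the total weight of the derivations. -/
theorem tsum_derivationsFrom_le {q : G.Rule → ℝ≥0∞} {z : G.NT → ℝ≥0∞}
    (h : ∀ i, ∑ π ∈ G.rulesFrom i, q π * G.stringProd z π.1.output ≤ z i)
    (v : List (Symbol T G.NT)) :
    ∑' πs : G.derivationsFrom v, (πs.1.map q).prod ≤ G.stringProd z v := by
  rw [ENNReal.tsum_eq_iSup_sum]
  refine iSup_le fun s => ?_
  -- A finite set of derivations has bounded length, so the truncated bound applies with the maximal
  -- length.
  refine le_trans ?_ (tsum_derivationsFrom_length_le h (s.sup fun πs => πs.1.length) v)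
  refine le_trans (le_of_eq (Finset.sum_congr rfl fun πs hπs => ?_)) (ENNReal.sum_le_tsum s)
  rw [if_pos (Finset.le_sup (f := fun πs : G.derivationsFrom v => πs.1.length) hπs)]

theorem summable_and_tsum_le_of_supersolution {q : G.Rule → ℝ} (hq : ∀ π, 0 ≤ q π) {z : G.NT → ℝ}
    (hz : ∀ i, 0 ≤ z i)
    (h : ∀ i, ∑ π ∈ G.rulesFrom i, q π * G.stringProd z π.1.output ≤ z i)
    (v : List (Symbol T G.NT)) :
    (Summable fun πs : G.derivationsFrom v => (πs.1.map q).prod) ∧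
      ∑' πs : G.derivationsFrom v, (πs.1.map q).prod ≤ G.stringProd z v := by
  have hof : ∀ w, ENNReal.ofReal (G.stringProd z w) =
      G.stringProd (fun i => ENNReal.ofReal (z i)) w := by
    intro w
    induction w with
    | nil => simp
    | cons s w ih =>
      cases s with
      | terminal a => simpa using ih
      | nonterminal i => simp [ENNReal.ofReal_mul (hz i), ih]
  have hz' : ∀ w, 0 ≤ G.stringProd z w := by
    intro w
    classical
    rw [stringProd_eq_prod_pow_count]
    exact Finset.prod_nonneg fun k _ => pow_nonneg (hz k) _
  have hqs : ∀ πs : List G.Rule, 0 ≤ (πs.map q).prod := fun πs =>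
    List.prod_nonneg fun x hx => by
      obtain ⟨π, -, rfl⟩ := List.mem_map.1 hx
      exact hq π
  have hqof : ∀ πs : List G.Rule, ENNReal.ofReal (πs.map q).prod =
      (πs.map fun π => ENNReal.ofReal (q π)).prod := by
    intro πs
    induction πs with
    | nil => simp
    | cons π πs ih => simp [ENNReal.ofReal_mul (hq π), ih]
  have key := tsum_derivationsFrom_le (G := G) (q := fun π => ENNReal.ofReal (q π))
    (z := fun i => ENNReal.ofReal (z i)) (fun i => by
      refine le_trans (le_of_eq ?_) (ENNReal.ofReal_le_ofReal (h i))
      rw [ENNReal.ofReal_sum_of_nonneg fun π _ => mul_nonneg (hq π) (hz' _)]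
      exact Finset.sum_congr rfl fun π _ => by rw [ENNReal.ofReal_mul (hq π), hof]) v
  simp only [← hqof, ← hof] at key
  have hs : Summable fun πs : G.derivationsFrom v => (πs.1.map q).prod := by
    refine (ENNReal.summable_toReal (ne_top_of_le_ne_top ENNReal.ofReal_ne_top key)).congr
      fun πs => ?_
    rw [ENNReal.toReal_ofReal (hqs _)]
  refine ⟨hs, ?_⟩
  rw [← ENNReal.ofReal_tsum_of_nonneg (fun πs => hqs _) hs] at key
  exact (ENNReal.ofReal_le_ofReal_iff (hz' v)).1 key

end Bound

end SCFG

/-! ### Matrices of spectral radius less than one. -/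

section Matrix

open Filter Topology

variable {n : Type*} [Fintype n] [DecidableEq n]

attribute [local instance] Matrix.linftyOpNormedRing Matrix.linftyOpNormedAlgebra in
-- By Gelfand's formula, ‖A^k‖ ≤ r^k eventually, for any r strictly between the spectral radius and
-- 1.
theorem Matrix.tendsto_pow_of_spectralRadius_lt_one {A : Matrix n n ℂ}
    (h : spectralRadius ℂ A < 1) : Tendsto (fun k => A ^ k) atTop (𝓝 0) := by
  obtain ⟨r, hr, hr1⟩ := exists_between h
  have hG := spectrum.pow_nnnorm_pow_one_div_tendsto_nhds_spectralRadius A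
  lift r to NNReal using ne_top_of_lt hr1
  have hr1' : r < 1 := by exact_mod_cast hr1
  refine tendsto_zero_iff_norm_tendsto_zero.2 ?_
  refine squeeze_zero' (Eventually.of_forall fun _ => norm_nonneg _) ?_
    (tendsto_pow_atTop_nhds_zero_of_lt_one r.2 hr1')
  filter_upwards [hG.eventually_lt_const hr, eventually_gt_atTop 0] with k hk hk0
  have hk0' : (k : ℝ) ≠ 0 := by positivity
  have := ENNReal.rpow_le_rpow hk.le (Nat.cast_nonneg (α := ℝ) k)
  rw [← ENNReal.rpow_mul, one_div, inv_mul_cancel₀ hk0', ENNReal.rpow_one,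
    ENNReal.rpow_natCast] at this
  have h2 : ‖A ^ k‖₊ ≤ r ^ k := by exact_mod_cast this
  exact_mod_cast h2

theorem Matrix.tendsto_pow_mulVec_of_spectralRadius_lt_one {A : Matrix n n ℝ}
    (h : spectralRadius ℂ (A.map (algebraMap ℝ ℂ)) < 1) (v : n → ℝ) :
    Tendsto (fun k => (A ^ k) *ᵥ v) atTop (𝓝 0) := by
  have h0 : Tendsto (fun k => A ^ k) atTop (𝓝 0) := by
    have := (Matrix.tendsto_pow_of_spectralRadius_lt_one h)
    have h2 := ((continuous_id.matrix_map Complex.continuous_re).tendsto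
      (0 : Matrix n n ℂ)).comp this
    refine (h2.congr fun k => ?_).trans (by simp)
    ext i j
    have : (A.map (algebraMap ℝ ℂ)) ^ k = (A ^ k).map (algebraMap ℝ ℂ) :=
      (Matrix.map_pow A (algebraMap ℝ ℂ) k).symm
    simp only [Function.comp_apply, id, this, Matrix.map_apply]
    simp
  have h3 := ((continuous_id.matrix_mulVec (continuous_const (y := v))).tendsto
    (0 : Matrix n n ℝ)).comp h0
  simpa [Function.comp_def] using h3

theorem Matrix.eq_zero_of_mulVec_eq {A : Matrix n n ℝ}
    (h : spectralRadius ℂ (A.map (algebraMap ℝ ℂ)) < 1) {v : n → ℝ} (hv : A *ᵥ v = v) :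
    v = 0 := by
  have hk : ∀ k, (A ^ k) *ᵥ v = v := by
    intro k
    induction k with
    | zero => simp
    | succ k ih => rw [pow_succ, ← Matrix.mulVec_mulVec, hv, ih]
  have := Matrix.tendsto_pow_mulVec_of_spectralRadius_lt_one h v
  simp only [hk] at this
  exact tendsto_nhds_unique tendsto_const_nhds this

theorem Matrix.isUnit_one_sub_of_spectralRadius_lt_one {A : Matrix n n ℝ}
    (h : spectralRadius ℂ (A.map (algebraMap ℝ ℂ)) < 1) : IsUnit (1 - A) := by
  rw [← Matrix.mulVec_injective_iff_isUnit]
  intro v w hvw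
  simp only [Matrix.sub_mulVec, Matrix.one_mulVec] at hvw
  refine sub_eq_zero.1 (Matrix.eq_zero_of_mulVec_eq h ?_)
  rw [Matrix.mulVec_sub]
  linear_combination (exp := 1) -hvw

omit [DecidableEq n] in
theorem Matrix.mulVec_mono {A : Matrix n n ℝ} (hA : ∀ i j, 0 ≤ A i j) {v w : n → ℝ}
    (h : v ≤ w) : A *ᵥ v ≤ A *ᵥ w := fun i =>
  Finset.sum_le_sum fun j _ => mul_le_mul_of_nonneg_left (h j) (hA i j)

/-- Monotonicity of A gives v ≤ A^k v for all k, and the right-hand side tends to 0. -/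
theorem Matrix.nonpos_of_le_mulVec {A : Matrix n n ℝ} (hA : ∀ i j, 0 ≤ A i j)
    (h : spectralRadius ℂ (A.map (algebraMap ℝ ℂ)) < 1) {v : n → ℝ} (hv : v ≤ A *ᵥ v) :
    v ≤ 0 := by
  have hk : ∀ k, v ≤ (A ^ k) *ᵥ v := by
    intro k
    induction k with
    | zero => simp
    | succ k ih =>
      rw [pow_succ', ← Matrix.mulVec_mulVec]
      exact hv.trans (Matrix.mulVec_mono hA ih)
  exact ge_of_tendsto' (Matrix.tendsto_pow_mulVec_of_spectralRadius_lt_one h v) hk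

/-- The vector w solves w - Aw = 1; it is nonnegative because -w ≤ A(-w). It supplies the direction
in which the fixed point 1 is perturbed. -/
theorem Matrix.exists_pos_mulVec_lt {A : Matrix n n ℝ} (hA : ∀ i j, 0 ≤ A i j)
    (h : spectralRadius ℂ (A.map (algebraMap ℝ ℂ)) < 1) :
    ∃ w : n → ℝ, (∀ i, 0 ≤ w i) ∧ ∀ i, (A *ᵥ w) i < w i := by
  have h1 := Matrix.isUnit_one_sub_of_spectralRadius_lt_one h
  obtain ⟨w, hw⟩ := (Matrix.mulVec_surjective_iff_isUnit.2 h1) 1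
  rw [Matrix.sub_mulVec, Matrix.one_mulVec] at hw
  have hi : ∀ i, w i - (A *ᵥ w) i = 1 := fun i => congrFun hw i
  refine ⟨w, fun i => ?_, fun i => by linarith [hi i]⟩
  have := Matrix.nonpos_of_le_mulVec hA h (v := -w) (fun i => by
    rw [Matrix.mulVec_neg]
    simp only [Pi.neg_apply]
    linarith [hi i]) i
  simpa using this

end Matrix

theorem one_sub_prod_le_sum {ι : Type*} {s : Finset ι} {a : ι → ℝ}
    (h : ∀ i ∈ s, 0 ≤ a i ∧ a i ≤ 1) :
    0 ≤ ∏ i ∈ s, a i ∧ ∏ i ∈ s, a i ≤ 1 ∧ 1 - ∏ i ∈ s, a i ≤ ∑ i ∈ s, (1 - a i) := by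
  classical
  induction s using Finset.induction_on with
  | empty => simp
  | insert i s hi ih =>
    obtain ⟨h0, h1, h2⟩ := ih fun j hj => h j (by simp [hj])
    obtain ⟨a0, a1⟩ := h i (by simp)
    rw [Finset.prod_insert hi, Finset.sum_insert hi]
    exact ⟨by positivity, by nlinarith, by nlinarith⟩

/-- A union bound over the factors followed by Bernoulli's inequality. Averaged over rules, it gives
1 - z ≤ M(1 - z) for a fixed point z. -/
theorem one_sub_prod_pow_le {ι : Type*} [Fintype ι] {z : ι → ℝ} (h0 : ∀ i, 0 ≤ z i)
    (h1 : ∀ i, z i ≤ 1) (r : ι → ℕ) :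
    1 - ∏ i, z i ^ r i ≤ ∑ i, (r i : ℝ) * (1 - z i) := by
  refine (one_sub_prod_le_sum fun i _ => ⟨pow_nonneg (h0 i) _, pow_le_one₀ (h0 i) (h1 i)⟩).2.2.trans
    (Finset.sum_le_sum fun i _ => ?_)
  have := one_add_mul_le_pow (a := z i - 1) (by linarith [h0 i]) (r i)
  rw [add_sub_cancel] at this
  linarith

/-! ### Exponential moments and absolute convergence. -/

namespace SCFG

open Filter Topology

variable {T : Type*} {G : SCFG T}

theorem expectationMatrix_nonneg (G : SCFG T) (i j : G.NT) : 0 ≤ G.expectationMatrix i j :=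
  Finset.sum_nonneg fun π _ => mul_nonneg (G.prob_mem π).1 (Nat.cast_nonneg _)

theorem expectationMatrix_mulVec (v : G.NT → ℝ) (i : G.NT) :
    (G.expectationMatrix *ᵥ v) i =
      ∑ π ∈ G.rulesFrom i, G.prob π * ∑ k, (G.occ π k : ℝ) * v k := by
  simp only [Matrix.mulVec, dotProduct, expectationMatrix, Matrix.of_apply, Finset.sum_mul,
    Finset.mul_sum]
  rw [Finset.sum_comm]
  simp only [mul_assoc]

theorem hasDerivAt_stringProd (w : G.NT → ℝ) (π : G.Rule) :
    HasDerivAt (fun ε : ℝ => G.stringProd (fun k => 1 + ε * w k) π.1.output)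
      (∑ k, (G.occ π k : ℝ) * w k) 0 := by
  simp only [stringProd_output]
  have h1 : ∀ k, HasDerivAt (fun ε : ℝ => (1 + ε * w k) ^ G.occ π k) ((G.occ π k : ℝ) * w k) 0 := by
    intro k
    have := (((hasDerivAt_id (0 : ℝ)).mul_const (w k)).const_add 1).fun_pow (G.occ π k)
    simpa using this
  have := HasDerivAt.fun_finsetProd (u := Finset.univ) fun k _ => h1 k
  simpa using this

/-- The difference `F` of the two sides vanishes at ε = 0 by properness, and its derivative there is
w_i - (Mw)_i > 0. -/
theorem eventually_supersolution (hprop : G.Proper) {w : G.NT → ℝ} {i : G.NT}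
    (hw : (G.expectationMatrix *ᵥ w) i < w i) :
    ∀ᶠ ε : ℝ in 𝓝[>] 0, ∑ π ∈ G.rulesFrom i,
      G.prob π * G.stringProd (fun k => 1 + ε * w k) π.1.output < 1 + ε * w i := by
  set F : ℝ → ℝ := fun ε => 1 + ε * w i - ∑ π ∈ G.rulesFrom i,
      G.prob π * G.stringProd (fun k => 1 + ε * w k) π.1.output with hF
  have hF0 : F 0 = 0 := by
    simp only [hF, zero_mul, add_zero, stringProd_output, one_pow, Finset.prod_const_one, mul_one]
    rw [hprop i, sub_self]
  have hd : HasDerivAt F (w i - (G.expectationMatrix *ᵥ w) i) 0 := by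
    rw [expectationMatrix_mulVec]
    have h1 : HasDerivAt (fun ε : ℝ => 1 + ε * w i) (w i) 0 := by
      simpa using ((hasDerivAt_id (0 : ℝ)).mul_const (w i)).const_add 1
    exact h1.sub (HasDerivAt.fun_sum fun π _ => (hasDerivAt_stringProd w π).const_mul _)
  have := hd.tendsto_slope_zero_right.eventually_const_lt (sub_pos.2 hw)
  filter_upwards [this, self_mem_nhdsWithin] with ε h1 h2
  rw [zero_add, hF0, sub_zero, smul_eq_mul] at h1
  have : 0 < F ε := by
    rw [Set.mem_Ioi] at h2
    exact pos_of_mul_pos_right (by simpa using h1) (by positivity)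
  simpa [hF] using this

/-- With ε fixed, the finitely many strict inequalities at t = 0 persist for small t > 0 by
continuity. -/
theorem exists_exponential_supersolution (hprop : G.Proper) (hrho : G.rho < 1) (y : G.Rule → ℝ) :
    ∃ t > 0, ∃ z : G.NT → ℝ, (∀ i, 0 ≤ z i) ∧ ∀ i, ∑ π ∈ G.rulesFrom i,
      G.prob π * Real.exp (t * y π) * G.stringProd z π.1.output ≤ z i := by
  obtain ⟨w, hw0, hw⟩ := Matrix.exists_pos_mulVec_lt G.expectationMatrix_nonneg hrho
  obtain ⟨ε, hε, hε0⟩ := ((eventually_all.2 fun i => eventually_supersolution hprop (hw i)).and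
    self_mem_nhdsWithin).exists
  have hε0 : 0 < ε := hε0
  have hc : ∀ i, ∀ᶠ t : ℝ in 𝓝[>] 0, ∑ π ∈ G.rulesFrom i, G.prob π * Real.exp (t * y π) *
      G.stringProd (fun k => 1 + ε * w k) π.1.output < 1 + ε * w i := by
    intro i
    have hcont : Continuous fun t : ℝ => ∑ π ∈ G.rulesFrom i, G.prob π * Real.exp (t * y π) *
      G.stringProd (fun k => 1 + ε * w k) π.1.output := by fun_prop
    have := hcont.tendsto 0
    simp only [zero_mul, Real.exp_zero, mul_one] at this
    exact (this.mono_left nhdsWithin_le_nhds).eventually_lt_const (hε i)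
  obtain ⟨t, ht, ht0⟩ := ((eventually_all.2 hc).and self_mem_nhdsWithin).exists
  exact ⟨t, ht0, _, fun i => by have := hw0 i; positivity, fun i => (ht i).le⟩

/-- Coordinatewise, (t|x|)^n / n! ≤ exp(t|x|), which accounts for the constant. -/
theorem multiPow_abs_le {D : ℕ} (α : Fin D → ℕ) {t : ℝ} (ht : 0 < t) :
    ∃ C : ℝ, ∀ x : Fin D → ℝ, |multiPow x α| ≤ C * Real.exp (t * ∑ d, |x d|) := by
  refine ⟨∏ d, ((α d)! / t ^ α d), fun x => ?_⟩
  rw [multiPow, Finset.abs_prod, Finset.mul_sum, Real.exp_sum, ← Finset.prod_mul_distrib]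
  refine Finset.prod_le_prod (fun d _ => abs_nonneg _) fun d _ => ?_
  have := Real.pow_div_factorial_le_exp (t * |x d|) (by positivity) (α d)
  rw [div_le_iff₀ (by positivity), mul_pow] at this
  rw [abs_pow, div_mul_eq_mul_div, le_div_iff₀ (by positivity)]
  linarith

theorem derivProb_nonneg (G : SCFG T) (πs : List G.Rule) : 0 ≤ G.derivProb πs :=
  List.prod_nonneg fun x hx => by
    obtain ⟨π, -, rfl⟩ := List.mem_map.1 hx
    exact (G.prob_mem π).1

theorem derivProb_append (a b : List G.Rule) :
    G.derivProb (a ++ b) = G.derivProb a * G.derivProb b := by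
  simp [derivProb]

theorem derivProb_cons (π : G.Rule) (b : List G.Rule) :
    G.derivProb (π :: b) = G.prob π * G.derivProb b := by
  simp [derivProb]

/-- The dominating weight p(π)·exp(t∑|Y_d(π)|) is multiplicative along a derivation, so the
supersolution bound applies to it. -/
theorem summable_derivProb_mul_multiPow (hprop : G.Proper) (hrho : G.rho < 1) {D : ℕ}
    (Y : G.Rule → Fin D → ℝ) (v : List (Symbol T G.NT)) (α : Fin D → ℕ) :
    Summable fun πs : G.derivationsFrom v => G.derivProb πs * multiPow (πs.1.map Y).sum α := by
  obtain ⟨t, ht, z, hz, hsup⟩ := exists_exponential_supersolution hprop hrho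
    fun π => ∑ d, |Y π d|
  have hs := (summable_and_tsum_le_of_supersolution
    (q := fun π => G.prob π * Real.exp (t * ∑ d, |Y π d|))
    (fun π => mul_nonneg (G.prob_mem π).1 (Real.exp_nonneg _)) hz hsup v).1
  obtain ⟨C, hC⟩ := multiPow_abs_le α ht
  have hC0 : 0 ≤ C := by
    have := (abs_nonneg _).trans (hC 0)
    exact nonneg_of_mul_nonneg_left this (Real.exp_pos _)
  refine Summable.of_norm_bounded (hs.mul_left C) fun πs => ?_
  rw [norm_mul, Real.norm_of_nonneg (G.derivProb_nonneg _), Real.norm_eq_abs]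
  have hprod : (πs.1.map fun π => G.prob π * Real.exp (t * ∑ d, |Y π d|)).prod =
      G.derivProb πs.1 * Real.exp (t * (πs.1.map fun π => ∑ d, |Y π d|).sum) := by
    induction πs.1 with
    | nil => simp [derivProb]
    | cons π πs ih =>
      rw [List.map_cons, List.prod_cons, ih, derivProb_cons, List.map_cons, List.sum_cons, mul_add,
        Real.exp_add]
      ring
  have hle : ∑ d, |(πs.1.map Y).sum d| ≤ (πs.1.map fun π => ∑ d, |Y π d|).sum := by
    induction πs.1 with
    | nil => simp
    | cons π πs ih =>
      simp only [List.map_cons, List.sum_cons, Pi.add_apply]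
      refine le_trans (Finset.sum_le_sum fun d _ => abs_add_le _ _) ?_
      rw [Finset.sum_add_distrib]
      gcongr
  rw [hprod, mul_left_comm]
  refine mul_le_mul_of_nonneg_left ((hC _).trans ?_) (G.derivProb_nonneg _)
  gcongr

end SCFG

/-! ### Multi-indices and their splittings. -/

section MultiIndex

variable {D : ℕ}

theorem multiFactorial_ne_zero (α : Fin D → ℕ) : (multiFactorial α : ℝ) ≠ 0 := by
  simp [multiFactorial, Finset.prod_ne_zero_iff, Nat.factorial_ne_zero]

theorem multiChoose_mul_multiFactorial {α β : Fin D → ℕ} (h : β ≤ α) :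
    multiChoose α β * multiFactorial β * multiFactorial (α - β) = multiFactorial α := by
  simp only [multiChoose, multiFactorial, ← Finset.prod_mul_distrib]
  exact Finset.prod_congr rfl fun d _ => Nat.choose_mul_factorial_mul_factorial (h d)

theorem multiChoose_self (α : Fin D → ℕ) : multiChoose α α = 1 := by simp [multiChoose]

theorem multiPow_zero (x : Fin D → ℝ) : multiPow x 0 = 1 := by simp [multiPow]

theorem multiFactorial_zero : multiFactorial (0 : Fin D → ℕ) = 1 := by simp [multiFactorial]

theorem multiMultinomial_mul_prod {ι : Type*} [Fintype ι] (α : Fin D → ℕ) (δ : ι → Fin D → ℕ)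
    (a : ι → ℝ) :
    multiMultinomial α δ * ∏ i, ((multiFactorial (δ i) : ℝ) * a i) =
      multiFactorial α * ∏ i, a i := by
  rw [Finset.prod_mul_distrib, multiMultinomial, ← mul_assoc, div_mul_cancel₀]
  exact Finset.prod_ne_zero_iff.2 fun i _ => multiFactorial_ne_zero _

theorem mem_splittings {ι : Type*} [Fintype ι] [DecidableEq ι] {α : Fin D → ℕ}
    {δ : ι → Fin D → ℕ} : δ ∈ splittings ι α ↔ ∑ i, δ i = α := by
  simp only [splittings, Finset.mem_filter, Fintype.mem_piFinset, Finset.mem_Iic,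
    and_iff_right_iff_imp]
  rintro rfl i
  exact Finset.single_le_sum (fun _ _ => zero_le) (Finset.mem_univ i)

theorem mem_properSplittings {ι : Type*} [Fintype ι] [DecidableEq ι] {α : Fin D → ℕ}
    {δ : ι → Fin D → ℕ} : δ ∈ properSplittings ι α ↔ (∀ i, δ i < α) ∧ ∑ i, δ i = α := by
  simp [properSplittings]

/-- A splitting of `α` is proper, or concentrated on a single index. -/
theorem sum_splittings {ι : Type*} [Fintype ι] [DecidableEq ι] {α : Fin D → ℕ} (hα : α ≠ 0)
    (f : (ι → Fin D → ℕ) → ℝ) :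
    ∑ δ ∈ splittings ι α, f δ =
      ∑ n, f (Pi.single n α) + ∑ δ ∈ properSplittings ι α, f δ := by
  have hne : ∀ n, (Pi.single n α : ι → Fin D → ℕ) ∉ properSplittings ι α := by
    intro n h
    have := (mem_properSplittings.1 h).1 n
    simp at this
  -- This is where α ≠ 0 matters: for α = 0 all concentrated families coincide.
  have hinj : Function.Injective fun n : ι => (Pi.single n α : ι → Fin D → ℕ) := by
    intro n k h
    by_contra hnk
    have := congrFun h n
    simp only [Pi.single_eq_same, Pi.single_eq_of_ne hnk] at this
    exact hα this
  have hunion : splittings ι α =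
      (Finset.univ.image fun n : ι => (Pi.single n α : ι → Fin D → ℕ)) ∪ properSplittings ι α := by
    ext δ
    simp only [Finset.mem_union, Finset.mem_image, Finset.mem_univ, true_and, mem_splittings,
      mem_properSplittings]
    constructor
    · intro h
      have hle : ∀ i, δ i ≤ α := fun i => by
        rw [← h]
        exact Finset.single_le_sum (fun _ _ => zero_le) (Finset.mem_univ i)
      by_cases hex : ∃ n, δ n = α
      · obtain ⟨n, hn⟩ := hex
        refine .inl ⟨n, ?_⟩
        rw [← Finset.add_sum_erase _ _ (Finset.mem_univ n), hn, add_eq_left,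
          Finset.sum_eq_zero_iff] at h
        ext1 k
        by_cases hk : k = n
        · subst hk
          simp [hn]
        · rw [Pi.single_eq_of_ne hk, h k (by simp [hk])]
      · push Not at hex
        exact .inr ⟨fun i => lt_of_le_of_ne (hle i) (hex i), h⟩
    · rintro (⟨n, rfl⟩ | h)
      · exact Finset.sum_pi_single' n α Finset.univ |>.trans (by simp)
      · exact h.2
  rw [hunion, Finset.sum_union, Finset.sum_image fun a _ b _ h => hinj h]
  rw [Finset.disjoint_left]
  intro δ h
  obtain ⟨n, -, rfl⟩ := Finset.mem_image.1 h
  exact hne n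

end MultiIndex

/-! ### Coefficients of power series and the exponential series. -/

namespace MvPowerSeries

variable {D : ℕ}

/-- The coefficient at a multi-index. -/
noncomputable def coeffAt (α : Fin D → ℕ) : MvPowerSeries (Fin D) ℝ →ₗ[ℝ] ℝ :=
  coeff (Finsupp.equivFunOnFinite.symm α)

theorem ext_coeffAt {f g : MvPowerSeries (Fin D) ℝ} (h : ∀ α, coeffAt α f = coeffAt α g) :
    f = g := by
  ext α
  simpa [coeffAt] using h α

theorem coeffAt_mul (f g : MvPowerSeries (Fin D) ℝ) (α : Fin D → ℕ) :
    coeffAt α (f * g) = ∑ β ∈ Finset.Iic α, coeffAt β f * coeffAt (α - β) g := by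
  rw [coeffAt, coeff_mul]
  refine Finset.sum_bij' (fun p _ => ⇑p.1)
    (fun β _ => (Finsupp.equivFunOnFinite.symm β, Finsupp.equivFunOnFinite.symm (α - β)))
    ?_ ?_ ?_ ?_ ?_
  · intro p hp
    rw [Finset.HasAntidiagonal.mem_antidiagonal] at hp
    have := congrArg DFunLike.coe hp
    simp only [Finsupp.coe_add, Finsupp.coe_equivFunOnFinite_symm] at this
    rw [Finset.mem_Iic, ← this]
    exact le_self_add
  · intro β hβ
    rw [Finset.mem_Iic] at hβ
    rw [Finset.HasAntidiagonal.mem_antidiagonal]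
    ext d
    simpa using Nat.add_sub_cancel' (hβ d)
  · intro p hp
    rw [Finset.HasAntidiagonal.mem_antidiagonal] at hp
    have := congrArg DFunLike.coe hp
    simp only [Finsupp.coe_add, Finsupp.coe_equivFunOnFinite_symm] at this
    refine Prod.ext (by ext; simp) ?_
    ext d
    simp [← this]
  · intro β _
    simp
  · intro p hp
    rw [Finset.HasAntidiagonal.mem_antidiagonal] at hp
    have := congrArg DFunLike.coe hp
    simp only [Finsupp.coe_add, Finsupp.coe_equivFunOnFinite_symm] at this
    simp [coeffAt, ← this]

theorem coeffAt_prod {ι : Type*} [Fintype ι] [DecidableEq ι] (f : ι → MvPowerSeries (Fin D) ℝ)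
    (α : Fin D → ℕ) :
    coeffAt α (∏ i, f i) = ∑ δ ∈ splittings ι α, ∏ i, coeffAt (δ i) (f i) := by
  rw [coeffAt, coeff_prod]
  refine Finset.sum_bij' (fun l _ i => ⇑(l i))
    (fun δ _ => Finsupp.equivFunOnFinite.symm fun i => Finsupp.equivFunOnFinite.symm (δ i))
    ?_ ?_ ?_ ?_ ?_
  · intro l hl
    rw [Finset.mem_finsuppAntidiag] at hl
    rw [mem_splittings]
    ext d
    have := DFunLike.congr_fun hl.1 d
    simpa [Finsupp.finsetSum_apply] using this
  · intro δ hδ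
    rw [mem_splittings] at hδ
    rw [Finset.mem_finsuppAntidiag]
    refine ⟨?_, Finset.subset_univ _⟩
    ext d
    simp [Finsupp.finsetSum_apply, ← hδ]
  · intro l _
    ext
    simp
  · intro δ _
    simp
  · intro l _
    simp [coeffAt]

theorem coeffAt_pow (f : MvPowerSeries (Fin D) ℝ) (r : ℕ) (α : Fin D → ℕ) :
    coeffAt α (f ^ r) = ∑ δ ∈ splittings (Fin r) α, ∏ l, coeffAt (δ l) f := by
  rw [← coeffAt_prod fun _ : Fin r => f]
  simp

theorem coeffAt_zero_eq (f : MvPowerSeries (Fin D) ℝ) :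
    coeffAt 0 f = constantCoeff f := by
  rw [coeffAt, ← coeff_zero_eq_constantCoeff_apply]
  congr 2
  ext
  simp

/-- The power series of `exp (x₁ z₁ + ⋯ + x_D z_D)`. -/
noncomputable def expLinear (x : Fin D → ℝ) : MvPowerSeries (Fin D) ℝ :=
  fun α => multiPow x α / multiFactorial α

@[simp]
theorem coeffAt_expLinear (x : Fin D → ℝ) (α : Fin D → ℕ) :
    coeffAt α (expLinear x) = multiPow x α / multiFactorial α := rfl

/-- The coefficient identity factors over the coordinates into ordinary binomial theorems. -/
theorem expLinear_add (x y : Fin D → ℝ) :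
    expLinear (x + y) = expLinear x * expLinear y := by
  refine ext_coeffAt fun α => ?_
  have hIic : Finset.Iic α = Fintype.piFinset fun d => Finset.Iic (α d) := by
    ext β
    simp [Pi.le_def]
  simp only [coeffAt_mul, coeffAt_expLinear, multiPow, multiFactorial, Nat.cast_prod,
    ← Finset.prod_div_distrib, ← Finset.prod_mul_distrib, Pi.add_apply, Pi.sub_apply, hIic]
  rw [← Finset.prod_univ_sum (fun d => Finset.Iic (α d)) fun d b =>
    x d ^ b / (b ! : ℝ) * (y d ^ (α d - b) / ((α d - b)! : ℝ))]
  refine Finset.prod_congr rfl fun d _ => ?_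
  rw [add_pow, Finset.sum_div, show Finset.Iic (α d) = Finset.range (α d + 1) by
    ext; simp]
  refine Finset.sum_congr rfl fun b hb => ?_
  rw [Nat.cast_choose ℝ (Nat.lt_succ_iff.1 (Finset.mem_range.1 hb))]
  have := Nat.factorial_ne_zero (α d)
  field_simp

/-- The series is a nonzero idempotent in a domain. -/
theorem expLinear_zero : expLinear (0 : Fin D → ℝ) = 1 := by
  have h := expLinear_add (0 : Fin D → ℝ) 0
  have h0 : constantCoeff (expLinear (0 : Fin D → ℝ)) = 1 := by
    rw [← coeffAt_zero_eq, coeffAt_expLinear, multiPow_zero, multiFactorial_zero]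
    simp
  rw [add_zero] at h
  have hne : expLinear (0 : Fin D → ℝ) ≠ 0 := by
    intro h1
    simp [h1] at h0
  exact mul_left_cancel₀ hne (by rw [← h, mul_one])

end MvPowerSeries

/-! ### Functional equation for the moment series. -/

namespace SCFG

open MvPowerSeries

variable {T : Type*} {G : SCFG T} {D : ℕ}

/-- The exponential generating function of the moments of the derivations from `v`. -/
noncomputable def momentSeries (G : SCFG T) (Y : G.Rule → Fin D → ℝ) (v : List (Symbol T G.NT)) :
    MvPowerSeries (Fin D) ℝ :=
  fun α => ∑' πs : G.derivationsFrom v,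
    G.derivProb πs * coeffAt α (expLinear (πs.1.map Y).sum)

theorem coeffAt_momentSeries (Y : G.Rule → Fin D → ℝ) (v : List (Symbol T G.NT))
    (α : Fin D → ℕ) :
    coeffAt α (G.momentSeries Y v) = ∑' πs : G.derivationsFrom v,
      G.derivProb πs * coeffAt α (expLinear (πs.1.map Y).sum) := rfl

section

variable (hprop : G.Proper) (hrho : G.rho < 1) (Y : G.Rule → Fin D → ℝ)

include hprop hrho in
theorem summable_derivProb_mul_coeffAt (v : List (Symbol T G.NT)) (α : Fin D → ℕ) :
    Summable fun πs : G.derivationsFrom v =>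
      G.derivProb πs * coeffAt α (expLinear (πs.1.map Y).sum) := by
  simp only [coeffAt_expLinear, ← mul_div_assoc]
  exact (summable_derivProb_mul_multiPow hprop hrho Y v α).div_const _

theorem momentSeries_nil : G.momentSeries Y [] = 1 := by
  refine ext_coeffAt fun α => ?_
  rw [coeffAt_momentSeries, tsum_derivationsFrom_nil fun πs =>
    G.derivProb πs * coeffAt α (expLinear (πs.map Y).sum)]
  simp only [derivProb, List.map_nil, List.prod_nil, List.sum_nil, one_mul, expLinear_zero]

theorem momentSeries_terminal_cons (a : T) (v : List (Symbol T G.NT)) :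
    G.momentSeries Y (Symbol.terminal a :: v) = G.momentSeries Y v := by
  refine ext_coeffAt fun α => ?_
  rw [coeffAt_momentSeries, coeffAt_momentSeries, derivationsFrom_terminal_cons]

include hprop hrho in
-- Unique factorization turns the sum into one over pairs, and additivity of X makes the
-- exponentials multiply; absolute convergence permits the Cauchy product in each coefficient.
theorem momentSeries_append (v w : List (Symbol T G.NT)) :
    G.momentSeries Y (v ++ w) = G.momentSeries Y v * G.momentSeries Y w := by
  refine ext_coeffAt fun α => ?_
  have hs := summable_derivProb_mul_coeffAt hprop hrho Y
  rw [coeffAt_mul, coeffAt_momentSeries, ← (G.appendEquiv v w).tsum_eq]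
  simp only [coe_appendEquiv, derivProb_append, List.map_append, List.sum_append, expLinear_add,
    coeffAt_mul _ _ α, Finset.mul_sum, coeffAt_momentSeries]
  rw [Summable.tsum_finsetSum]
  · refine Finset.sum_congr rfl fun β _ => ?_
    rw [tsum_mul_tsum_of_summable_norm (hs v β).norm (hs w (α - β)).norm]
    exact tsum_congr fun x => by ring
  · intro β _
    exact (summable_mul_of_summable_norm (hs v β).norm (hs w (α - β)).norm).congr
      fun x => by ring

include hprop hrho in
theorem momentSeries_nonterminal (i : G.NT) :
    G.momentSeries Y [Symbol.nonterminal i] =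
      ∑ π ∈ G.rulesFrom i, G.prob π • (G.momentSeries Y π.1.output * expLinear (Y π)) := by
  refine ext_coeffAt fun α => ?_
  have hs := summable_derivProb_mul_coeffAt hprop hrho Y
  rw [coeffAt_momentSeries, ← (G.nonterminalConsEquiv i []).tsum_eq]
  refine (Summable.tsum_sigma ((G.nonterminalConsEquiv i []).summable_iff.2 (hs _ _))).trans ?_
  rw [tsum_fintype, map_sum, ← Finset.sum_coe_sort (G.rulesFrom i)]
  refine Finset.sum_congr rfl fun π _ => ?_
  simp only [Function.comp_apply, coe_nonterminalConsEquiv, derivProb_cons, List.map_cons,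
    List.sum_cons, add_comm (Y _), expLinear_add, coeffAt_mul _ _ α, Finset.mul_sum, coeffAt_momentSeries, map_smul, smul_eq_mul]
  rw [List.append_nil, Summable.tsum_finsetSum]
  · refine Finset.sum_congr rfl fun β _ => ?_
    rw [← tsum_mul_right, ← tsum_mul_left]
    exact tsum_congr fun x => by ring
  · intro β _
    exact (((hs π.1.1.output β).mul_right (coeffAt (α - β) (expLinear (Y π)))).mul_left
      (G.prob π)).congr fun x => by ring

include hprop hrho in
theorem momentSeries_eq_stringProd (v : List (Symbol T G.NT)) :
    G.momentSeries Y v =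
      G.stringProd (fun k => G.momentSeries Y [Symbol.nonterminal k]) v := by
  induction v with
  | nil => simp [momentSeries_nil]
  | cons s v ih =>
    cases s with
    | terminal a => rw [momentSeries_terminal_cons, stringProd_terminal_cons, ih]
    | nonterminal i =>
      rw [stringProd_nonterminal_cons, ← ih, ← momentSeries_append hprop hrho]
      rfl

include hprop hrho in
/-- The derivations from a nonterminal have total weight one. -/
theorem constantCoeff_momentSeries (i : G.NT) :
    constantCoeff (G.momentSeries Y [Symbol.nonterminal i]) = 1 := by
  set z : G.NT → ℝ := fun i => constantCoeff (G.momentSeries Y [Symbol.nonterminal i]) with hz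
  have hzsum : ∀ i, z i = ∑' πs : G.derivationsFrom [Symbol.nonterminal i],
      G.derivProb πs := fun i => by
    simp only [hz, ← coeffAt_zero_eq, coeffAt_momentSeries, coeffAt_expLinear, multiPow_zero,
      multiFactorial_zero, Nat.cast_one, div_one, mul_one]
  have hz0 : ∀ i, 0 ≤ z i := fun i => by
    rw [hzsum]
    exact tsum_nonneg fun πs => G.derivProb_nonneg _
  have hone : ∀ v, G.stringProd (fun _ => (1 : ℝ)) v = 1 := fun v => by
    classical simp [stringProd_eq_prod_pow_count]
  -- By properness the constant vector 1 is itself a supersolution.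
  have hz1 : ∀ i, z i ≤ 1 := fun i => by
    rw [hzsum]
    have := (summable_and_tsum_le_of_supersolution (fun π => (G.prob_mem π).1)
      (z := fun _ : G.NT => (1 : ℝ)) (fun _ => zero_le_one)
      (fun i => by simp only [hone, mul_one]; exact (hprop i).le) [Symbol.nonterminal i]).2
    rwa [hone] at this
  have hfix : ∀ i, z i = ∑ π ∈ G.rulesFrom i, G.prob π * ∏ k, z k ^ G.occ π k := fun i => by
    simp only [hz]
    rw [momentSeries_nonterminal hprop hrho, map_sum]
    refine Finset.sum_congr rfl fun π _ => ?_
    rw [smul_eq_C_mul, map_mul, map_mul, constantCoeff_C, momentSeries_eq_stringProd hprop hrho,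
      stringProd_output, map_prod, ← coeffAt_zero_eq (expLinear _), coeffAt_expLinear,
      multiPow_zero, multiFactorial_zero]
    simp
  -- The defect 1 - z satisfies 1 - z ≤ M(1 - z), which rules out positive entries.
  have hle := Matrix.nonpos_of_le_mulVec G.expectationMatrix_nonneg hrho (v := fun i => 1 - z i)
    fun i => by
      rw [expectationMatrix_mulVec]
      simp only
      conv_lhs => rw [hfix i, ← hprop i, ← Finset.sum_sub_distrib]
      refine Finset.sum_le_sum fun π _ => ?_
      rw [← mul_one_sub]
      refine mul_le_mul_of_nonneg_left ?_ (G.prob_mem π).1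
      exact one_sub_prod_pow_le hz0 hz1 _
  have := hle i
  simp only [Pi.zero_apply] at this
  linarith [hz1 i]

end

end SCFG

/-! ### Extracting the linear system from the functional equation. -/

namespace SCFG

open MvPowerSeries

variable {T : Type*} {G : SCFG T} {D : ℕ}

theorem powTerm_congr {m m' : (Fin D → ℕ) → G.NT → ℝ} {γ : Fin D → ℕ}
    (h : ∀ β ≤ γ, m β = m' β) (π : G.Rule) (k : G.NT) :
    G.powTerm m π k γ = G.powTerm m' π k γ := by
  refine Finset.sum_congr rfl fun δ hδ => ?_
  congr 1
  refine Finset.prod_congr rfl fun l _ => ?_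
  rw [h]
  rw [← mem_splittings.1 hδ]
  exact Finset.single_le_sum (fun _ _ => zero_le) (Finset.mem_univ l)

theorem H_congr {m m' : (Fin D → ℕ) → G.NT → ℝ} {γ : G.NT → Fin D → ℕ}
    (h : ∀ k, ∀ β ≤ γ k, m β = m' β) (π : G.Rule) (α : Fin D → ℕ) :
    G.H m π α γ = G.H m' π α γ := by
  simp only [H, fun k => powTerm_congr (h k) π k]

/-- The inhomogeneous term involves only the moments of smaller order. -/
theorem c_congr {m m' : (Fin D → ℕ) → G.NT → ℝ} {α : Fin D → ℕ} (h : ∀ β < α, m β = m' β)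
    (Y : G.Rule → Fin D → ℝ) : G.c Y m α = G.c Y m' α := by
  have h1 : ∀ (r : ℕ) (n : G.NT), ∀ δ ∈ properSplittings (Fin r) α,
      multiMultinomial α δ * ∏ l, m (δ l) n = multiMultinomial α δ * ∏ l, m' (δ l) n :=
    fun r n δ hδ => by
      rw [Finset.prod_congr rfl fun l _ => by rw [h _ ((mem_properSplittings.1 hδ).1 l)]]
  have h2 : ∀ π : G.Rule, ∀ γ ∈ properSplittings G.NT α, G.H m π α γ = G.H m' π α γ :=
    fun π γ hγ => H_congr
      (fun k β hβ => h β (hβ.trans_lt ((mem_properSplittings.1 hγ).1 k))) π α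
  have h3 : ∀ π : G.Rule, ∀ β ∈ Finset.Iio α, G.Q Y m π α β = G.Q Y m' π α β :=
    fun π β hβ => by
      rw [Q, Q, Finset.sum_congr rfl fun γ hγ => H_congr (fun k β' hβ' => h β' ?_) π β]
      refine (hβ'.trans ?_).trans_lt (Finset.mem_Iio.1 hβ)
      rw [← mem_splittings.1 hγ]
      exact Finset.single_le_sum (fun _ _ => zero_le) (Finset.mem_univ k)
  ext i
  simp only [c, Finset.sum_congr rfl (h1 _ _), Finset.sum_congr rfl (h2 _),
    Finset.sum_congr rfl (h3 _)]

section Expansion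

variable {m : (Fin D → ℕ) → G.NT → ℝ} {f : G.NT → MvPowerSeries (Fin D) ℝ}
  (hm : ∀ α k, m α k = multiFactorial α * coeffAt α (f k))

include hm in
-- Multinomial coefficients cancel the factorials in the moments, so the sum over splittings is the
-- coefficient formula for a power.
theorem powTerm_eq_coeffAt (π : G.Rule) (k : G.NT) (γ : Fin D → ℕ) :
    G.powTerm m π k γ = multiFactorial γ * coeffAt γ (f k ^ G.occ π k) := by
  simp only [powTerm, hm, multiMultinomial_mul_prod, coeffAt_pow, Finset.mul_sum]

include hm in
theorem sum_H_eq_coeffAt (π : G.Rule) (β : Fin D → ℕ) :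
    ∑ γ ∈ splittings G.NT β, G.H m π β γ =
      multiFactorial β * coeffAt β (∏ k, f k ^ G.occ π k) := by
  simp only [H, powTerm_eq_coeffAt hm, multiMultinomial_mul_prod, coeffAt_prod, Finset.mul_sum]

end Expansion

theorem multiMultinomial_single {ι : Type*} [Fintype ι] [DecidableEq ι] (α : Fin D → ℕ) (n : ι) :
    multiMultinomial α (Pi.single n α) = 1 := by
  rw [multiMultinomial, Finset.prod_eq_single n, Pi.single_eq_same, div_self
    (multiFactorial_ne_zero α)]
  · intro k _ hk
    rw [Pi.single_eq_of_ne hk, multiFactorial_zero, Nat.cast_one]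
  · simp

theorem powTerm_zero {m : (Fin D → ℕ) → G.NT → ℝ} (hm : ∀ k, m 0 k = 1) (π : G.Rule) (k : G.NT) :
    G.powTerm m π k 0 = 1 := by
  have : splittings (Fin (G.occ π k)) (0 : Fin D → ℕ) = {0} := by
    ext δ
    simp [mem_splittings, Finset.sum_eq_zero_iff, funext_iff]
  simp [powTerm, this, hm, multiMultinomial, multiFactorial_zero]

/-- Each of the r concentrated splittings contributes the moment of order α times moments of order
0, which equal 1. -/
theorem powTerm_eq {m : (Fin D → ℕ) → G.NT → ℝ} (hm : ∀ k, m 0 k = 1) {α : Fin D → ℕ}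
    (hα : α ≠ 0) (π : G.Rule) (k : G.NT) :
    G.powTerm m π k α = G.occ π k * m α k +
      ∑ δ ∈ properSplittings (Fin (G.occ π k)) α, multiMultinomial α δ * ∏ l, m (δ l) k := by
  rw [powTerm, sum_splittings hα]
  congr 1
  rw [Finset.sum_congr rfl fun n _ => ?_, Finset.sum_const, Finset.card_univ, Fintype.card_fin,
    nsmul_eq_mul]
  rw [multiMultinomial_single, one_mul, Finset.prod_eq_single n, Pi.single_eq_same]
  · intro l _ hl
    rw [Pi.single_eq_of_ne hl, hm]
  · simp

theorem sum_H_eq {m : (Fin D → ℕ) → G.NT → ℝ} (hm : ∀ k, m 0 k = 1) {α : Fin D → ℕ}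
    (hα : α ≠ 0) (π : G.Rule) :
    ∑ γ ∈ splittings G.NT α, G.H m π α γ =
      ∑ k, (G.occ π k : ℝ) * m α k +
      ∑ k, ∑ δ ∈ properSplittings (Fin (G.occ π k)) α, multiMultinomial α δ * ∏ l, m (δ l) k +
      ∑ γ ∈ properSplittings G.NT α, G.H m π α γ := by
  rw [sum_splittings hα, ← Finset.sum_add_distrib]
  congr 1
  refine Finset.sum_congr rfl fun n _ => ?_
  rw [← powTerm_eq hm hα, H, multiMultinomial_single, one_mul, Finset.prod_eq_single n,
    Pi.single_eq_same]
  · intro k _ hk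
    rw [Pi.single_eq_of_ne hk, powTerm_zero hm]
  · simp

section Moments

variable {Y : G.Rule → Fin D → ℝ} {X : List G.Rule → Fin D → ℝ}
  (hX : ∀ (i : G.NT), ∀ πs ∈ G.Omega i, X πs = (πs.map Y).sum)

include hX in
theorem moment_eq_coeffAt (α : Fin D → ℕ) (i : G.NT) :
    G.moment X α i =
      multiFactorial α * coeffAt α (G.momentSeries Y [Symbol.nonterminal i]) := by
  rw [coeffAt_momentSeries, ← tsum_mul_left, moment]
  refine tsum_congr fun πs => ?_
  rw [hX i πs.1 πs.2, coeffAt_expLinear]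
  have := multiFactorial_ne_zero α
  field_simp

variable (hprop : G.Proper) (hrho : G.rho < 1)

include hX hprop hrho

theorem moment_zero (i : G.NT) : G.moment X 0 i = 1 := by
  rw [moment_eq_coeffAt hX, coeffAt_zero_eq, constantCoeff_momentSeries hprop hrho,
    multiFactorial_zero, Nat.cast_one, mul_one]

theorem moment_eq_sum (α : Fin D → ℕ) (i : G.NT) :
    G.moment X α i = ∑ π ∈ G.rulesFrom i, G.prob π * ∑ β ∈ Finset.Iic α,
      multiChoose α β * multiPow (Y π) (α - β) *
        ∑ γ ∈ splittings G.NT β, G.H (G.moment X) π β γ := by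
  rw [moment_eq_coeffAt hX, momentSeries_nonterminal hprop hrho, map_sum, Finset.mul_sum]
  refine Finset.sum_congr rfl fun π _ => ?_
  rw [map_smul, smul_eq_mul, momentSeries_eq_stringProd hprop hrho, stringProd_output,
    coeffAt_mul, mul_left_comm, Finset.mul_sum]
  congr 1
  refine Finset.sum_congr rfl fun β hβ => ?_
  rw [sum_H_eq_coeffAt (moment_eq_coeffAt hX), coeffAt_expLinear,
    ← multiChoose_mul_multiFactorial (Finset.mem_Iic.1 hβ)]
  have := multiFactorial_ne_zero (α - β)
  push_cast
  field_simp

theorem moment_eq_mulVec_add {α : Fin D → ℕ} (hα : α ≠ 0) :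
    G.moment X α =
      G.expectationMatrix *ᵥ G.moment X α + G.c Y (G.moment X) α := by
  ext i
  rw [moment_eq_sum hX hprop hrho, Pi.add_apply, expectationMatrix_mulVec, c]
  simp only [← Finset.sum_add_distrib]
  refine Finset.sum_congr rfl fun π _ => ?_
  -- Moments of order α occur only in the term β = α, where the power of Y is 1.
  rw [← Finset.Iio_insert α, Finset.sum_insert (by simp), multiChoose_self, tsub_self,
    multiPow_zero, sum_H_eq (moment_zero hX hprop hrho) hα]
  simp only [Q, mul_add, Finset.mul_sum, mul_one, one_mul, Nat.cast_one, add_assoc]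
  congr 3
  refine Finset.sum_congr rfl fun β _ => Finset.sum_congr rfl fun γ _ => ?_
  ring

end Moments

end SCFG

theorem mainTheorem1 {T : Type*} (G : SCFG T) (hred : G.Reduced) (hprop : G.Proper)
    (hrho : G.rho < 1) {D : ℕ} (Y : G.Rule → Fin D → ℝ) (X : List G.Rule → Fin D → ℝ)
    (hX : ∀ (i : G.NT), ∀ πs ∈ G.Omega i, X πs = (πs.map Y).sum) :
    (∀ (α : Fin D → ℕ) (i : G.NT),
      Summable fun πs : G.Omega i => G.derivProb πs * multiPow (X πs) α) ∧
    (∀ i : G.NT, G.moment X 0 i = 1) ∧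
    IsUnit (1 - G.expectationMatrix) ∧
    ∀ α : Fin D → ℕ, α ≠ 0 →
      -- `c^(α)` involves only the moments of orders `β < α`
      (∀ m' : (Fin D → ℕ) → G.NT → ℝ, (∀ β < α, m' β = G.moment X β) →
        G.c Y m' α = G.c Y (G.moment X) α) ∧
      G.moment X α = G.expectationMatrix *ᵥ G.moment X α + G.c Y (G.moment X) α ∧
      (∀ v : G.NT → ℝ, v = G.expectationMatrix *ᵥ v + G.c Y (G.moment X) α →
        v = G.moment X α) ∧
      G.moment X α = (1 - G.expectationMatrix)⁻¹ *ᵥ G.c Y (G.moment X) α := by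
  have hunit := Matrix.isUnit_one_sub_of_spectralRadius_lt_one hrho
  -- Inverting I - M for an arbitrary solution yields both uniqueness and the closed form.
  have hsol : ∀ (v : G.NT → ℝ) (α : Fin D → ℕ),
      v = G.expectationMatrix *ᵥ v + G.c Y (G.moment X) α →
        v = (1 - G.expectationMatrix)⁻¹ *ᵥ G.c Y (G.moment X) α := by
    intro v α hv
    have : G.c Y (G.moment X) α = (1 - G.expectationMatrix) *ᵥ v := by
      rw [Matrix.sub_mulVec, Matrix.one_mulVec]
      exact eq_sub_of_add_eq' hv.symm
    rw [this, Matrix.mulVec_mulVec,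
      Matrix.nonsing_inv_mul _ ((Matrix.isUnit_iff_isUnit_det _).1 hunit), Matrix.one_mulVec]
  refine ⟨fun α i => ?_, SCFG.moment_zero hX hprop hrho, hunit, fun α hα => ?_⟩
  -- `Omega i` and `derivationsFrom [Symbol.nonterminal i]` agree by definition.
  · refine (SCFG.summable_derivProb_mul_multiPow hprop hrho Y [Symbol.nonterminal i] α).congr
      fun πs => ?_
    rw [hX i πs.1 πs.2]
  · have hm := SCFG.moment_eq_mulVec_add hX hprop hrho hα
    exact ⟨fun m' h => SCFG.c_congr h Y, hm,
      fun v hv => (hsol v α hv).trans (hsol _ α hm).symm, hsol _ α hm⟩
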